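/- Let $(\Omega,\mathcal F,P)$ be a probability space with a filtration $\mathbb F=(\mathcal F_t)_{t\ge 0}$. Let $Z=(Z_t)_{t\ge 0}$ be an increasing process, i.e. a real-valued adapted process whose paths are a.s. nondecreasing and right-continuous. For $t>0$ let $\Delta Z_t=Z_t-Z_{t-}$, and let $\Delta Z_0=Z_0$ (the convention $Z_{0-}=0$). Suppose that $Z$ has an absolutely continuous compensator: there exists a nonnegative adapted process $\lambda$, with a.s. locally integrable paths, such that $$Z_t-\int_0^t\lambda_s\,ds,\qquad t\ge 0,$$ is a martingale. Let $R$ be a stopping time with values in $[0,\infty]$ such that $\Delta Z_R>0$ a.s. on $\{R<\infty\}$. Then $R$ has an absolutely continuous compensator: there exists a nonnegative adapted process $\mu$, with a.s. locally integrable paths, such that $$1_{\{t\ge R\}}-\int_0^t\mu_s\,ds,\qquad t\ge 0,$$ is a martingale. -/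

import Mathlib

open MeasureTheory Filter Topology
open scoped NNReal

/-- The jump `Δf(t) = f(t) - f(t-)` of a path `f : [0, ∞) → ℝ`, with the usual convention
`f(0-) = 0` at time zero (so `Δf(0) = f(0)`, which vanishes when the path starts at `0`). -/
noncomputable def pathJump (f : ℝ≥0 → ℝ) (t : ℝ≥0) : ℝ :=
  if t = 0 then f 0 else f t - Function.leftLim f t

/-- An increasing process: adapted, with almost surely nondecreasing right-continuous paths
(such paths have left limits by monotonicity, so they are càdlàg). -/
structure IsIncreasingProcess {Ω : Type*} {m : MeasurableSpace Ω} (𝓕 : Filtration ℝ≥0 m)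
    (P : Measure Ω) (Z : ℝ≥0 → Ω → ℝ) : Prop where
  adapted : StronglyAdapted 𝓕 Z
  monotone : ∀ᵐ ω ∂P, Monotone fun t => Z t ω
  rightCts : ∀ᵐ ω ∂P, ∀ t : ℝ≥0, ContinuousWithinAt (fun s => Z s ω) (Set.Ici t) t

/-- `X` has an absolutely continuous compensator: there is a nonnegative adapted process `l`
with almost surely locally integrable paths such that `X_t - ∫₀ᵗ l_s ds` is a martingale.
(`s.toNNReal` only views the integration variable `s ≥ 0` as a time in `[0, ∞)`.) -/
def HasACCompensator {Ω : Type*} {m : MeasurableSpace Ω} (𝓕 : Filtration ℝ≥0 m)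
    (P : Measure Ω) (X : ℝ≥0 → Ω → ℝ) : Prop :=
  ∃ l : ℝ≥0 → Ω → ℝ,
    (∀ t ω, 0 ≤ l t ω) ∧
    StronglyAdapted 𝓕 l ∧
    (∀ᵐ ω ∂P, ∀ t : ℝ≥0, IntervalIntegrable (fun s : ℝ => l s.toNNReal ω) volume 0 (t : ℝ)) ∧
    Martingale (fun (t : ℝ≥0) ω => X t ω - ∫ s in (0 : ℝ)..(t : ℝ), l s.toNNReal ω) 𝓕 P

/-- The process `1_{t ≥ R}`, for a random time `R` with values in `[0, ∞]`. -/
noncomputable def timeIndicator {Ω : Type*} (R : Ω → WithTop ℝ≥0) (t : ℝ≥0) (ω : Ω) : ℝ :=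
  Set.indicator {ω' | R ω' ≤ (t : WithTop ℝ≥0)} (fun _ => 1) ω

/-! Write `A` for the integrated intensity of `Z`. As `Z - A` is a martingale, `dZ` and `dA` have,
after localisation, the same expected mass on every predictable set `B` (`lintegral_pathMeasure_Ioi`
on rectangles, `lintegral_section_eq_of_predictableRectangles` in general). If `B` is null for `dt ⊗
P`, then `dA` does not charge it, hence almost surely neither does `dZ`. But `dZ` has an atom at `R`
on `{0 < R < ∞}`, so `R` avoids `B` (`ae_notMem_of_predictable_null`). Thus `B ↦ P(0 < R < ∞, (R, ω)
∈ B)` is absolutely continuous with respect to `dt ⊗ P` on the predictable sets. Its predictable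
Radon–Nikodym density is the required intensity: testing it on `(s, t] × F` with `F ∈ 𝓕 s` gives the
martingale property (`hasACCompensator_of_density`). The event `{R = 0}` plays no role, since
increments of the indicator only see `R > 0`.

`A` need not be integrable, so one stops when it exceeds a level. The filtration is neither
right-continuous nor complete, so the crossing time is not treated as a stopping time. It is a
decreasing limit of the finite-valued `cappedTime`s, to which optional stopping applies; the limit
uses right-continuity and uniform integrability. -/

/-! ### Optional stopping along finite-valued approximations of a crossing time -/

section OptionalStopping

variable {Ω : Type*} {m : MeasurableSpace Ω}

/-- The time `T`, capped at those among the first `k` times of the sequence `q` at which `A`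
exceeds the level `c`. -/
noncomputable def cappedTime (A : ℝ≥0 → Ω → ℝ) (c : ℝ) (T : ℝ≥0) (q : ℕ → ℝ≥0) : ℕ → Ω → ℝ≥0
  | 0 => fun _ => T
  | k + 1 => fun ω =>
      if c < A (q k) ω then min (cappedTime A c T q k ω) (q k) else cappedTime A c T q k ω

lemma cappedTime_succ (A : ℝ≥0 → Ω → ℝ) (c : ℝ) (T : ℝ≥0) (q : ℕ → ℝ≥0) (k : ℕ) (ω : Ω) :
    cappedTime A c T q (k + 1) ω =
      if c < A (q k) ω then min (cappedTime A c T q k ω) (q k) else cappedTime A c T q k ω := rfl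

lemma antitone_cappedTime (A : ℝ≥0 → Ω → ℝ) (c : ℝ) (T : ℝ≥0) (q : ℕ → ℝ≥0) (ω : Ω) :
    Antitone fun k => cappedTime A c T q k ω := by
  refine antitone_nat_of_succ_le fun k => ?_
  rw [cappedTime_succ]
  split_ifs
  exacts [min_le_left _ _, le_rfl]

lemma cappedTime_le (A : ℝ≥0 → Ω → ℝ) (c : ℝ) (T : ℝ≥0) (q : ℕ → ℝ≥0) (k : ℕ) (ω : Ω) :
    cappedTime A c T q k ω ≤ T :=
  antitone_cappedTime A c T q ω (Nat.zero_le k)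

lemma le_cappedTime {A : ℝ≥0 → Ω → ℝ} {c : ℝ} {T : ℝ≥0} {q : ℕ → ℝ≥0} {ω : Ω} {t : ℝ≥0}
    (ht : t ≤ T) (h : ∀ s ≤ t, A s ω ≤ c) (k : ℕ) : t ≤ cappedTime A c T q k ω := by
  induction k with
  | zero => exact ht
  | succ k ih =>
    rw [cappedTime_succ]
    split_ifs with hc
    · refine le_min ih ?_
      by_contra! hlt
      exact absurd (h _ hlt.le) (not_le.2 hc)
    · exact ih

lemma finite_range_cappedTime (A : ℝ≥0 → Ω → ℝ) (c : ℝ) (T : ℝ≥0) (q : ℕ → ℝ≥0) (k : ℕ) :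
    (Set.range (cappedTime A c T q k)).Finite := by
  induction k with
  | zero => exact (Set.finite_singleton T).subset (by rintro _ ⟨ω, rfl⟩; rfl)
  | succ k ih =>
    refine (ih.insert (q k)).subset ?_
    rintro _ ⟨ω, rfl⟩
    rw [cappedTime_succ]
    split_ifs
    · rcases min_choice (cappedTime A c T q k ω) (q k) with h | h <;> rw [h] <;> simp
    · simp

lemma isStoppingTime_cappedTime {𝓕 : Filtration ℝ≥0 m} {A : ℝ≥0 → Ω → ℝ}
    (hA : StronglyAdapted 𝓕 A) (c : ℝ) (T : ℝ≥0) (q : ℕ → ℝ≥0) (k : ℕ) :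
    IsStoppingTime 𝓕 fun ω => (cappedTime A c T q k ω : WithTop ℝ≥0) := by
  induction k with
  | zero => exact isStoppingTime_const 𝓕 T
  | succ k ih =>
    intro i
    have : {ω | (cappedTime A c T q (k + 1) ω : WithTop ℝ≥0) ≤ i} =
        {ω | (cappedTime A c T q k ω : WithTop ℝ≥0) ≤ i} ∪ {ω | c < A (q k) ω ∧ q k ≤ i} := by
      ext ω
      simp only [Set.mem_ofPred_eq, Set.mem_union, cappedTime_succ, WithTop.coe_le_coe]
      split_ifs with h <;> simp [h]
    rw [this]
    refine (ih i).union ?_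
    by_cases hi : q k ≤ i
    · simp only [hi, and_true]
      exact measurableSet_lt measurable_const ((hA (q k)).mono (𝓕.mono hi)).measurable
    · simp [hi]

variable {P : Measure Ω} [IsProbabilityMeasure P] {𝓕 : Filtration ℝ≥0 m} {M : ℝ≥0 → Ω → ℝ}

lemma MeasureTheory.Martingale.stopped_ae_eq_condExp (hM : Martingale M 𝓕 P)
    {σ : Ω → ℝ≥0} (hσ : IsStoppingTime 𝓕 fun ω => (σ ω : WithTop ℝ≥0))
    (hr : (Set.range σ).Countable) {T : ℝ≥0} (hT : ∀ ω, σ ω ≤ T) :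
    (fun ω => M (σ ω) ω) =ᵐ[P] P[M T | hσ.measurableSpace] := by
  have hr' : (Set.range fun ω => (σ ω : WithTop ℝ≥0)).Countable := by
    have := hr.image (fun t : ℝ≥0 => (t : WithTop ℝ≥0))
    rwa [← Set.range_comp] at this
  have := hM.stoppedValue_ae_eq_condExp_of_le_const_of_countable_range hσ (n := T)
    (fun ω => WithTop.coe_le_coe.2 (hT ω)) hr'
  exact this

lemma MeasureTheory.Martingale.integrable_stopped (hM : Martingale M 𝓕 P)
    {σ : Ω → ℝ≥0} (hσ : IsStoppingTime 𝓕 fun ω => (σ ω : WithTop ℝ≥0))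
    (hr : (Set.range σ).Countable) {T : ℝ≥0} (hT : ∀ ω, σ ω ≤ T) :
    Integrable (fun ω => M (σ ω) ω) P :=
  integrable_condExp.congr (hM.stopped_ae_eq_condExp hσ hr hT).symm

/-- The values of a martingale at bounded stopping times converge in `L¹` as soon as they
converge almost surely. -/
lemma MeasureTheory.Martingale.tendsto_setIntegral_stopped (hM : Martingale M 𝓕 P)
    {σ : ℕ → Ω → ℝ≥0} (hσ : ∀ k, IsStoppingTime 𝓕 fun ω => (σ k ω : WithTop ℝ≥0))
    (hr : ∀ k, (Set.range (σ k)).Countable) {T : ℝ≥0} (hT : ∀ k ω, σ k ω ≤ T) {Y : Ω → ℝ}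
    (hY : ∀ᵐ ω ∂P, Tendsto (fun k => M (σ k ω) ω) atTop (𝓝 (Y ω))) :
    Integrable Y P ∧
      ∀ S : Set Ω, Tendsto (fun k => ∫ ω in S, M (σ k ω) ω ∂P) atTop (𝓝 (∫ ω in S, Y ω ∂P)) := by
  -- The stopped values are conditional expectations of the single variable `M T`, hence uniformly
  -- integrable; Vitali's theorem does the rest.
  have hui := (hM.integrable T).uniformIntegrable_condExp (fun k => (hσ k).measurableSpace_le)
  have hui' := hui.ae_eq fun k => (hM.stopped_ae_eq_condExp (hσ k) (hr k) (hT k)).symm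
  have hint k := hM.integrable_stopped (hσ k) (hr k) (hT k)
  have hYi : MemLp Y 1 P := hui'.memLp_of_ae_tendsto hY
  have hL := tendsto_Lp_finite_of_tendsto_ae le_rfl (by simp) (fun k => (hint k).1) hYi
    hui'.2.1 hY
  exact ⟨memLp_one_iff_integrable.1 hYi, fun S =>
    tendsto_setIntegral_of_L1' Y hYi.1 (Eventually.of_forall hint) hL S⟩

lemma MeasureTheory.IsStoppingTime.coe_min_const {σ : Ω → ℝ≥0}
    (hσ : IsStoppingTime 𝓕 fun ω => (σ ω : WithTop ℝ≥0)) (s : ℝ≥0) :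
    IsStoppingTime 𝓕 fun ω => ((min (σ ω) s : ℝ≥0) : WithTop ℝ≥0) := by
  simpa only [WithTop.coe_min] using hσ.min_const s

lemma Set.Countable.range_min {σ : Ω → ℝ≥0} (hr : (Set.range σ).Countable) (s : ℝ≥0) :
    (Set.range fun ω => min (σ ω) s).Countable := by
  have := hr.image fun t => min t s
  rwa [← Set.range_comp] at this

/-- Off `{s < σ}` the two times agree. The part of `F` inside `{s < σ}` belongs both to `𝓕 s` and to
the `σ`-algebra of `σ`, so there both integrals equal that of `M T` when `s ≤ T`; when `T ≤ s` this
part is empty. -/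
lemma MeasureTheory.Martingale.setIntegral_stopped_min (hM : Martingale M 𝓕 P)
    {σ : Ω → ℝ≥0} (hσ : IsStoppingTime 𝓕 fun ω => (σ ω : WithTop ℝ≥0))
    (hr : (Set.range σ).Countable) {T : ℝ≥0} (hT : ∀ ω, σ ω ≤ T) {s : ℝ≥0} {F : Set Ω}
    (hF : MeasurableSet[𝓕 s] F) :
    ∫ ω in F, M (σ ω) ω ∂P = ∫ ω in F, M (min (σ ω) s) ω ∂P := by
  have hi := hM.integrable_stopped hσ hr hT
  have his := hM.integrable_stopped (hσ.coe_min_const s) (hr.range_min s) (T := s) fun ω => min_le_right _ _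
  have hm : MeasurableSet[𝓕 s] {ω | s < σ ω} := by
    have := (hσ s).compl
    convert this using 1
    ext ω
    exact (not_le (a := σ ω) (b := s)).symm.trans (not_congr WithTop.coe_le_coe.symm)
  set G := F ∩ {ω | s < σ ω} with hG
  have hGs : MeasurableSet[𝓕 s] G := hF.inter hm
  have hF' := 𝓕.le s _ hF
  have hm' := 𝓕.le s _ hm
  have key : ∫ ω in G, M (σ ω) ω ∂P = ∫ ω in G, M (min (σ ω) s) ω ∂P := by
    have e1 : ∫ ω in G, M (min (σ ω) s) ω ∂P = ∫ ω in G, M s ω ∂P := by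
      refine setIntegral_congr_fun (𝓕.le s _ hGs) fun ω hω => ?_
      simp only [min_eq_right (show s ≤ σ ω from hω.2.le)]
    rw [e1]
    rcases le_total s T with hsT | hTs
    · have hGσ : MeasurableSet[hσ.measurableSpace] G := by
        refine (hσ.measurableSet G).2 ⟨le_iSup (fun t => (𝓕 t : MeasurableSpace Ω)) s _ hGs,
          fun i => ?_⟩
        rcases le_total s i with hsi | his
        · exact (𝓕.mono hsi _ hGs).inter (hσ i)
        · convert MeasurableSet.empty
          refine Set.eq_empty_iff_forall_notMem.2 fun ω hω => ?_
          have h1 : s < σ ω := hω.1.2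
          have h2 : σ ω ≤ i := WithTop.coe_le_coe.1 hω.2
          exact absurd (h2.trans his) (not_le.2 h1)
      rw [integral_congr_ae (ae_restrict_of_ae (hM.stopped_ae_eq_condExp hσ hr hT)),
        setIntegral_condExp hσ.measurableSpace_le (hM.integrable T) hGσ,
        hM.setIntegral_eq hsT hGs]
    · have : G = ∅ := Set.eq_empty_iff_forall_notMem.2 fun ω hω =>
        absurd ((hT ω).trans hTs) (not_le.2 hω.2)
      simp [this]
  have hc : ∫ ω in F \ {ω | s < σ ω}, M (σ ω) ω ∂P =
      ∫ ω in F \ {ω | s < σ ω}, M (min (σ ω) s) ω ∂P := by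
    refine setIntegral_congr_fun (hF'.diff hm') fun ω hω => ?_
    have : σ ω ≤ s := not_lt.1 hω.2
    simp only [min_eq_left this]
  rw [← integral_inter_add_sdiff hm' hi.integrableOn, ← integral_inter_add_sdiff hm' his.integrableOn]
  exact congr_arg₂ _ key hc

end OptionalStopping

/-! ### The predictable σ-algebra and uniqueness of expectations on it -/

section Predictable

variable {Ω : Type*} {m : MeasurableSpace Ω}

/-- The rectangles `(s, ∞) × F` with `F ∈ 𝓕 s`. -/
def predictableRectangles (𝓕 : Filtration ℝ≥0 m) : Set (Set (ℝ × Ω)) :=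
  {B | ∃ (s : ℝ≥0) (F : Set Ω), MeasurableSet[𝓕 s] F ∧ B = Set.Ioi (s : ℝ) ×ˢ F}

/-- The predictable `σ`-algebra, for processes extended to the time set `ℝ`. -/
@[reducible] def predictableSpace (𝓕 : Filtration ℝ≥0 m) : MeasurableSpace (ℝ × Ω) :=
  MeasurableSpace.generateFrom (predictableRectangles 𝓕)

lemma measurableSet_predictableSpace_Ioi_prod {𝓕 : Filtration ℝ≥0 m} {s : ℝ≥0} {F : Set Ω}
    (hF : MeasurableSet[𝓕 s] F) : MeasurableSet[predictableSpace 𝓕] (Set.Ioi (s : ℝ) ×ˢ F) :=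
  MeasurableSpace.measurableSet_generateFrom ⟨s, F, hF, rfl⟩

lemma isPiSystem_predictableRectangles (𝓕 : Filtration ℝ≥0 m) :
    IsPiSystem (predictableRectangles 𝓕) := by
  rintro _ ⟨s, F, hF, rfl⟩ _ ⟨s', F', hF', rfl⟩ -
  refine ⟨max s s', F ∩ F', (𝓕.mono (le_max_left _ _) _ hF).inter
    (𝓕.mono (le_max_right _ _) _ hF'), ?_⟩
  rw [Set.prod_inter_prod, Set.Ioi_inter_Ioi, NNReal.coe_max]

lemma predictableSpace_le (𝓕 : Filtration ℝ≥0 m) :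
    predictableSpace 𝓕 ≤ (inferInstance : MeasurableSpace (ℝ × Ω)) := by
  refine MeasurableSpace.generateFrom_le ?_
  rintro _ ⟨s, F, hF, rfl⟩
  exact measurableSet_Ioi.prod (𝓕.le s _ hF)

/-- Freezing time at `t` makes predictable processes progressively measurable: a rectangle starting
before `t` lies in `𝓕 t` already, and one starting later has empty preimage. -/
lemma measurable_min_predictableSpace (𝓕 : Filtration ℝ≥0 m) (t : ℝ≥0) :
    @Measurable (ℝ × Ω) (ℝ × Ω) (@Prod.instMeasurableSpace ℝ Ω _ (𝓕 t)) (predictableSpace 𝓕)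
      fun p => (min p.1 t, p.2) := by
  refine @measurable_generateFrom _ _ (@Prod.instMeasurableSpace ℝ Ω _ (𝓕 t)) _ _ ?_
  rintro _ ⟨s, F, hF, rfl⟩
  rcases lt_or_ge s t with hst | hts
  · have : (fun p : ℝ × Ω => (min p.1 (t : ℝ), p.2)) ⁻¹' (Set.Ioi (s : ℝ) ×ˢ F) =
        Set.Ioi (s : ℝ) ×ˢ F := by
      ext p
      simp [hst]
    rw [this]
    exact @MeasurableSet.prod ℝ Ω _ (𝓕 t) _ _ measurableSet_Ioi (𝓕.mono hst.le _ hF)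
  · have : (fun p : ℝ × Ω => (min p.1 (t : ℝ), p.2)) ⁻¹' (Set.Ioi (s : ℝ) ×ˢ F) = ∅ := by
      ext p
      simp only [Set.mem_preimage, Set.mem_prod, Set.mem_Ioi, lt_inf_iff, NNReal.coe_lt_coe,
        Set.mem_empty_iff_false, iff_false]
      exact fun h => absurd h.1.2 (not_lt.2 hts)
    rw [this]
    exact @MeasurableSet.empty _ (@Prod.instMeasurableSpace ℝ Ω _ (𝓕 t))

lemma measurable_prodMk_predictableSpace (𝓕 : Filtration ℝ≥0 m) (t : ℝ≥0) :
    @Measurable Ω (ℝ × Ω) (𝓕 t) (predictableSpace 𝓕) fun ω => ((t : ℝ), ω) := by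
  have h := (measurable_min_predictableSpace 𝓕 t).comp
    (@measurable_prodMk_left ℝ Ω _ (𝓕 t) (t : ℝ))
  simpa [Function.comp_def] using h

/-- Two families of measures on the time axis which have the same expectations on the predictable
rectangles have the same expectations on all predictable sets. -/
lemma lintegral_section_eq_of_predictableRectangles {P : Measure Ω} (𝓕 : Filtration ℝ≥0 m)
    {z a : Ω → Measure ℝ} (hz : ∀ ω, IsFiniteMeasure (z ω)) (ha : ∀ ω, IsFiniteMeasure (a ω))
    (hz0 : ∀ ω, z ω (Set.Iic 0) = 0) (ha0 : ∀ ω, a ω (Set.Iic 0) = 0)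
    (hzm : ∀ s : ℝ≥0, AEMeasurable (fun ω => z ω (Set.Ioi s)) P)
    (ham : ∀ s : ℝ≥0, AEMeasurable (fun ω => a ω (Set.Ioi s)) P)
    (hfin : ∫⁻ ω, a ω (Set.Ioi 0) ∂P ≠ ⊤)
    (heq : ∀ (s : ℝ≥0) (F : Set Ω), MeasurableSet[𝓕 s] F →
      ∫⁻ ω in F, z ω (Set.Ioi s) ∂P = ∫⁻ ω in F, a ω (Set.Ioi s) ∂P)
    {B : Set (ℝ × Ω)} (hB : MeasurableSet[predictableSpace 𝓕] B) :
    AEMeasurable (fun ω => z ω ((Prod.mk · ω) ⁻¹' B)) P ∧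
      ∫⁻ ω, z ω ((Prod.mk · ω) ⁻¹' B) ∂P = ∫⁻ ω, a ω ((Prod.mk · ω) ⁻¹' B) ∂P := by
  have univ_eq : ∀ {y : Measure ℝ}, y (Set.Iic 0) = 0 → y Set.univ = y (Set.Ioi (0 : ℝ≥0)) := by
    intro y hy
    rw [NNReal.coe_zero]
    exact (measure_eq_measure_of_null_sdiff (Set.subset_univ _)
      (by rwa [← Set.compl_eq_univ_sdiff, Set.compl_Ioi])).symm
  have hsec : ∀ {C : Set (ℝ × Ω)} (ω : Ω), MeasurableSet[predictableSpace 𝓕] C →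
      MeasurableSet ((Prod.mk · ω) ⁻¹' C) := fun ω hC =>
    measurable_prodMk_right (predictableSpace_le 𝓕 _ hC)
  -- The whole space is not a rectangle. Since nothing is charged up to time `0`, the rectangle
  -- starting at `0` replaces it and supplies the total mass needed for complements.
  have hu : ∫⁻ ω, z ω Set.univ ∂P = ∫⁻ ω, a ω Set.univ ∂P := by
    have := heq 0 Set.univ MeasurableSet.univ
    simpa only [Measure.restrict_univ, univ_eq (hz0 _), univ_eq (ha0 _)] using this
  have hu' : ∫⁻ ω, a ω Set.univ ∂P ≠ ⊤ := by simpa only [univ_eq (ha0 _), NNReal.coe_zero] using hfin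
  suffices H : AEMeasurable (fun ω => z ω ((Prod.mk · ω) ⁻¹' B)) P ∧
      AEMeasurable (fun ω => a ω ((Prod.mk · ω) ⁻¹' B)) P ∧
      ∫⁻ ω, z ω ((Prod.mk · ω) ⁻¹' B) ∂P = ∫⁻ ω, a ω ((Prod.mk · ω) ⁻¹' B) ∂P from
    ⟨H.1, H.2.2⟩
  induction B, hB using MeasurableSpace.induction_on_inter (m := predictableSpace 𝓕) rfl
    (isPiSystem_predictableRectangles 𝓕) with
  | empty => simp
  | basic C hC =>
    obtain ⟨s, F, hF, rfl⟩ := hC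
    have hF' := 𝓕.le s _ hF
    have key : ∀ y : Ω → Measure ℝ, (fun ω => y ω ((Prod.mk · ω) ⁻¹' (Set.Ioi (s : ℝ) ×ˢ F))) =
        F.indicator fun ω => y ω (Set.Ioi s) := by
      intro y
      ext ω
      by_cases h : ω ∈ F
      · simp only [Set.indicator_of_mem h]
        congr 1
        ext t; simp [h]
      · rw [Set.indicator_of_notMem h]
        convert measure_empty (μ := y ω)
        ext t; simp [h]
    rw [key, key, lintegral_indicator hF', lintegral_indicator hF']
    exact ⟨(hzm s).indicator hF', (ham s).indicator hF', heq s F hF⟩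
  | compl C hC ih =>
    have key : ∀ {y : Ω → Measure ℝ}, (∀ ω, IsFiniteMeasure (y ω)) →
        (fun ω => y ω ((Prod.mk · ω) ⁻¹' Cᶜ)) =
          fun ω => y ω Set.univ - y ω ((Prod.mk · ω) ⁻¹' C) := by
      intro y hy
      ext ω
      rw [Set.preimage_compl, measure_compl (hsec ω hC) (measure_ne_top _ _)]
    have hzu : AEMeasurable (fun ω => z ω Set.univ) P := by
      simpa only [univ_eq (hz0 _)] using hzm 0
    have hau : AEMeasurable (fun ω => a ω Set.univ) P := by
      simpa only [univ_eq (ha0 _)] using ham 0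
    rw [key hz, key ha]
    have hle : ∀ y : Ω → Measure ℝ,
        ∀ᵐ ω ∂P, y ω ((Prod.mk · ω) ⁻¹' C) ≤ y ω Set.univ := fun y =>
      Eventually.of_forall fun ω => measure_mono (Set.subset_univ _)
    have hfa : ∫⁻ ω, a ω ((Prod.mk · ω) ⁻¹' C) ∂P ≠ ⊤ :=
      ne_top_of_le_ne_top hu' (lintegral_mono_ae (hle a))
    refine ⟨hzu.sub ih.1, hau.sub ih.2.1, ?_⟩
    rw [lintegral_sub' ih.1 (ih.2.2 ▸ hfa) (hle z), lintegral_sub' ih.2.1 hfa (hle a), hu, ih.2.2]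
  | iUnion C hd hC ih =>
    have key : ∀ y : Ω → Measure ℝ, (fun ω => y ω ((Prod.mk · ω) ⁻¹' ⋃ i, C i)) =
        fun ω => ∑' i, y ω ((Prod.mk · ω) ⁻¹' C i) := by
      intro y
      ext ω
      rw [Set.preimage_iUnion, measure_iUnion (fun i j hij => (hd hij).preimage _)
        fun i => hsec ω (hC i)]
    rw [key, key]
    refine ⟨AEMeasurable.tsum fun i => (ih i).1, AEMeasurable.tsum fun i => (ih i).2.1, ?_⟩
    rw [lintegral_tsum fun i => (ih i).1, lintegral_tsum fun i => (ih i).2.1]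
    exact tsum_congr fun i => (ih i).2.2

end Predictable

/-! ### Comparison of `dZ` with its compensator, and the null sets avoided by `R` -/

section Compensator

variable {Ω : Type*} {m : MeasurableSpace Ω}

/-- The integrated intensity `∫₀ᵗ l_s ds`. -/
noncomputable def cumulativeIntensity (l : ℝ≥0 → Ω → ℝ) (t : ℝ≥0) (ω : Ω) : ℝ :=
  ∫ s in (0 : ℝ)..(t : ℝ), l s.toNNReal ω

/-- The path of `Z` at `ω` is nondecreasing and right-continuous, and that of `l` is nonnegative and
locally integrable. -/
structure RegularPath (Z l : ℝ≥0 → Ω → ℝ) (ω : Ω) : Prop where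
  mono : Monotone fun t => Z t ω
  rightCts : ∀ t : ℝ≥0, ContinuousWithinAt (fun s => Z s ω) (Set.Ici t) t
  nonneg : ∀ t, 0 ≤ l t ω
  integrable : ∀ t : ℝ≥0, IntervalIntegrable (fun s : ℝ => l s.toNNReal ω) volume 0 (t : ℝ)

namespace RegularPath

variable {Z l : ℝ≥0 → Ω → ℝ} {ω : Ω}

lemma intervalIntegrable (h : RegularPath Z l ω) (s t : ℝ≥0) :
    IntervalIntegrable (fun u : ℝ => l u.toNNReal ω) volume (s : ℝ) (t : ℝ) :=
  (h.integrable s).symm.trans (h.integrable t)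

lemma cumulativeIntensity_sub (h : RegularPath Z l ω) (s t : ℝ≥0) :
    cumulativeIntensity l t ω - cumulativeIntensity l s ω =
      ∫ u in (s : ℝ)..(t : ℝ), l u.toNNReal ω :=
  intervalIntegral.integral_interval_sub_left (h.integrable t) (h.integrable s)

lemma monotone_cumulativeIntensity (h : RegularPath Z l ω) :
    Monotone fun t => cumulativeIntensity l t ω := by
  intro s t hst
  rw [← sub_nonneg, h.cumulativeIntensity_sub]
  exact intervalIntegral.integral_nonneg (NNReal.coe_le_coe.2 hst) fun u _ => h.nonneg _

lemma continuous_cumulativeIntensity (h : RegularPath Z l ω) :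
    Continuous fun t => cumulativeIntensity l t ω := by
  rw [continuous_iff_continuousAt]
  intro t
  have hi : IntegrableOn (fun u : ℝ => l u.toNNReal ω) (Set.uIcc (0 : ℝ) ((t + 1 : ℝ≥0) : ℝ)) := by
    rw [Set.uIcc_of_le (NNReal.coe_nonneg _), integrableOn_Icc_iff_integrableOn_Ioc,
      ← intervalIntegrable_iff_integrableOn_Ioc_of_le (NNReal.coe_nonneg _)]
    exact h.integrable _
  have hc := intervalIntegral.continuousOn_primitive_interval hi
  rw [Set.uIcc_of_le (NNReal.coe_nonneg _)] at hc
  have hmap : ContinuousOn (fun s : ℝ≥0 => (s : ℝ)) (Set.Iio (t + 1)) :=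
    NNReal.continuous_coe.continuousOn
  have := hc.comp hmap fun s hs =>
    ⟨NNReal.coe_nonneg s, NNReal.coe_le_coe.2 (le_of_lt hs)⟩
  exact this.continuousAt (Iio_mem_nhds (lt_add_one t))

/-- The path of `Z`, extended to negative times by its initial value. -/
noncomputable def stieltjes (h : RegularPath Z l ω) : StieltjesFunction ℝ where
  toFun s := Z s.toNNReal ω
  mono' := h.mono.comp fun _ _ => Real.toNNReal_mono
  right_continuous' s := (h.rightCts s.toNNReal).comp continuous_real_toNNReal.continuousWithinAt
    fun _ hu => Real.toNNReal_le_toNNReal hu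

lemma stieltjes_coe (h : RegularPath Z l ω) (t : ℝ≥0) : h.stieltjes t = Z t ω := by
  change Z (t : ℝ).toNNReal ω = _
  rw [Real.toNNReal_coe]

/-- Only one inequality between the left limits over `ℝ` and over `ℝ≥0` is needed. As `r ≠ 0`,
clipping a real time below `r` at `0` still leaves it below `r`. -/
lemma stieltjes_singleton_pos (h : RegularPath Z l ω) {r : ℝ≥0} (hr : r ≠ 0)
    (hj : 0 < pathJump (fun s => Z s ω) r) : 0 < h.stieltjes.measure {(r : ℝ)} := by
  rw [StieltjesFunction.measure_singleton, ENNReal.ofReal_pos, h.stieltjes_coe]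
  rw [pathJump, if_neg hr] at hj
  refine hj.trans_le (sub_le_sub_left ?_ _)
  rw [h.stieltjes.mono.leftLim_eq_sSup]
  refine csSup_le (Set.nonempty_Iio.image _) ?_
  rintro _ ⟨s, hs, rfl⟩
  have hlt : s.toNNReal < r := by
    rw [← NNReal.coe_lt_coe, Real.coe_toNNReal', max_lt_iff]
    exact ⟨hs, NNReal.coe_pos.2 (pos_iff_ne_zero.2 hr)⟩
  exact h.mono.le_leftLim hlt

end RegularPath

open scoped Classical in
/-- The random measure `dZ` on the interval `(0, σ]`. -/
noncomputable def pathMeasure (Z l : ℝ≥0 → Ω → ℝ) (σ : Ω → ℝ≥0) (ω : Ω) : Measure ℝ :=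
  if h : RegularPath Z l ω then h.stieltjes.measure.restrict (Set.Ioc 0 (σ ω)) else 0

open scoped Classical in
/-- The random measure `l_s ds` on the interval `(0, σ]`. -/
noncomputable def intensityMeasure (Z l : ℝ≥0 → Ω → ℝ) (σ : Ω → ℝ≥0) (ω : Ω) : Measure ℝ :=
  if RegularPath Z l ω then
    (volume.withDensity fun s : ℝ => ENNReal.ofReal (l s.toNNReal ω)).restrict (Set.Ioc 0 (σ ω))
  else 0

variable {Z l : ℝ≥0 → Ω → ℝ} {σ : Ω → ℝ≥0}

lemma Ioi_inter_Ioc_zero_coe (s t : ℝ≥0) :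
    Set.Ioi (s : ℝ) ∩ Set.Ioc 0 (t : ℝ) = Set.Ioc ((min t s : ℝ≥0) : ℝ) t := by
  ext u
  simp only [Set.mem_inter_iff, Set.mem_Ioi, Set.mem_Ioc, NNReal.coe_min, inf_lt_iff]
  constructor
  · rintro ⟨h1, -, h2⟩
    exact ⟨Or.inr h1, h2⟩
  · rintro ⟨h1 | h1, h2⟩
    · exact absurd h1 (not_lt.2 h2)
    · exact ⟨h1, (NNReal.coe_nonneg s).trans_lt h1, h2⟩

lemma pathMeasure_Ioi {ω : Ω} (h : RegularPath Z l ω) (s : ℝ≥0) :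
    pathMeasure Z l σ ω (Set.Ioi s) = ENNReal.ofReal (Z (σ ω) ω - Z (min (σ ω) s) ω) := by
  rw [pathMeasure, dif_pos h, Measure.restrict_apply measurableSet_Ioi, Ioi_inter_Ioc_zero_coe,
    StieltjesFunction.measure_Ioc, h.stieltjes_coe, h.stieltjes_coe]

lemma intensityMeasure_Ioi {ω : Ω} (h : RegularPath Z l ω) (s : ℝ≥0) :
    intensityMeasure Z l σ ω (Set.Ioi s) =
      ENNReal.ofReal (cumulativeIntensity l (σ ω) ω - cumulativeIntensity l (min (σ ω) s) ω) := by
  have hle : ((min (σ ω) s : ℝ≥0) : ℝ) ≤ σ ω := NNReal.coe_le_coe.2 (min_le_left _ _)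
  rw [intensityMeasure, if_pos h, Measure.restrict_apply measurableSet_Ioi,
    Ioi_inter_Ioc_zero_coe, withDensity_apply _ measurableSet_Ioc, h.cumulativeIntensity_sub,
    intervalIntegral.integral_of_le hle, ofReal_integral_eq_lintegral_ofReal]
  · exact (intervalIntegrable_iff_integrableOn_Ioc_of_le hle).1 (h.intervalIntegrable _ _)
  · exact Eventually.of_forall fun u => h.nonneg _

lemma pathMeasure_Iic (ω : Ω) : pathMeasure Z l σ ω (Set.Iic 0) = 0 := by
  rw [pathMeasure]
  split_ifs with h
  · rw [Measure.restrict_apply measurableSet_Iic]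
    convert measure_empty (μ := h.stieltjes.measure)
    ext u; simp only [Set.mem_inter_iff, Set.mem_Iic, Set.mem_Ioc, Set.mem_empty_iff_false, iff_false]
    exact fun hu => absurd hu.2.1 (not_lt.2 hu.1)
  · rfl

lemma intensityMeasure_Iic (ω : Ω) : intensityMeasure Z l σ ω (Set.Iic 0) = 0 := by
  rw [intensityMeasure]
  split_ifs with h
  · rw [Measure.restrict_apply measurableSet_Iic]
    convert measure_empty
      (μ := volume.withDensity fun s : ℝ => ENNReal.ofReal (l s.toNNReal ω))
    ext u; simp only [Set.mem_inter_iff, Set.mem_Iic, Set.mem_Ioc, Set.mem_empty_iff_false, iff_false]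
    exact fun hu => absurd hu.2.1 (not_lt.2 hu.1)
  · rfl

lemma isFiniteMeasure_of_Iic_of_Ioi {y : Measure ℝ} (h0 : y (Set.Iic 0) = 0)
    (h1 : y (Set.Ioi 0) ≠ ⊤) : IsFiniteMeasure y := by
  refine ⟨?_⟩
  rw [← Set.Iic_union_Ioi (a := (0 : ℝ))]
  refine (measure_union_le _ _).trans_lt ?_
  rw [h0, zero_add]
  exact h1.lt_top

lemma isFiniteMeasure_pathMeasure (ω : Ω) : IsFiniteMeasure (pathMeasure Z l σ ω) := by
  by_cases h : RegularPath Z l ω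
  · refine isFiniteMeasure_of_Iic_of_Ioi (pathMeasure_Iic ω) ?_
    rw [← NNReal.coe_zero, pathMeasure_Ioi h]
    exact ENNReal.ofReal_ne_top
  · rw [pathMeasure, dif_neg h]
    infer_instance

lemma isFiniteMeasure_intensityMeasure (ω : Ω) : IsFiniteMeasure (intensityMeasure Z l σ ω) := by
  by_cases h : RegularPath Z l ω
  · refine isFiniteMeasure_of_Iic_of_Ioi (intensityMeasure_Iic ω) ?_
    rw [← NNReal.coe_zero, intensityMeasure_Ioi h]
    exact ENNReal.ofReal_ne_top
  · rw [intensityMeasure, if_neg h]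
    infer_instance

lemma intensityMeasure_eq_zero {ω : Ω} {N : Set ℝ} (hNm : MeasurableSet N)
    (hN : volume (N ∩ Set.Ioi 0) = 0) : intensityMeasure Z l σ ω N = 0 := by
  rw [intensityMeasure]
  split_ifs
  · rw [Measure.restrict_apply hNm]
    refine withDensity_absolutelyContinuous _ _ (measure_mono_null ?_ hN)
    exact Set.inter_subset_inter_right _ Set.Ioc_subset_Ioi_self
  · rfl

variable {P : Measure Ω} [IsProbabilityMeasure P] {𝓕 : Filtration ℝ≥0 m}

lemma measurable_comp_of_countable_range {X : ℝ≥0 → Ω → ℝ} (hX : ∀ t, Measurable (X t))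
    (hσ : IsStoppingTime 𝓕 fun ω => (σ ω : WithTop ℝ≥0)) (hr : (Set.range σ).Countable) :
    Measurable fun ω => X (σ ω) ω := by
  intro S hS
  have : (fun ω => X (σ ω) ω) ⁻¹' S = ⋃ i ∈ Set.range σ, {ω | σ ω = i} ∩ X i ⁻¹' S := by
    ext ω
    simp only [Set.mem_preimage, Set.mem_iUnion, Set.mem_inter_iff, Set.mem_ofPred_eq, exists_prop]
    exact ⟨fun h => ⟨σ ω, ⟨ω, rfl⟩, rfl, h⟩, fun ⟨i, _, hi, h⟩ => hi ▸ h⟩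
  rw [this]
  refine MeasurableSet.biUnion hr fun i _ => MeasurableSet.inter ?_ (hX i hS)
  have := 𝓕.le i _ (hσ.measurableSet_eq i)
  convert this using 1
  ext ω
  exact WithTop.coe_inj.symm

/-- Expectations over predictable rectangles of `dZ` and of `l_s ds` up to a time `σ`, the limit of a
decreasing sequence of bounded stopping times, at which the integrated intensity is bounded. -/
lemma lintegral_pathMeasure_Ioi
    (hreg : ∀ᵐ ω ∂P, RegularPath Z l ω)
    (hM : Martingale (fun t ω => Z t ω - cumulativeIntensity l t ω) 𝓕 P)
    (hA : StronglyAdapted 𝓕 (cumulativeIntensity l))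
    {τ : ℕ → Ω → ℝ≥0} (hτ : ∀ k, IsStoppingTime 𝓕 fun ω => (τ k ω : WithTop ℝ≥0))
    (hr : ∀ k, (Set.range (τ k)).Countable) {T : ℝ≥0} (hT : ∀ k ω, τ k ω ≤ T)
    (hle : ∀ k ω, σ ω ≤ τ k ω) (hlim : ∀ ω, Tendsto (fun k => τ k ω) atTop (𝓝 (σ ω)))
    {c : ℝ} (hc : ∀ᵐ ω ∂P, cumulativeIntensity l (σ ω) ω ≤ c) (s : ℝ≥0) :
    AEMeasurable (fun ω => pathMeasure Z l σ ω (Set.Ioi s)) P ∧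
    AEMeasurable (fun ω => intensityMeasure Z l σ ω (Set.Ioi s)) P ∧
    ∫⁻ ω, intensityMeasure Z l σ ω (Set.Ioi s) ∂P ≠ ⊤ ∧
    ∀ F : Set Ω, MeasurableSet[𝓕 s] F →
      ∫⁻ ω in F, pathMeasure Z l σ ω (Set.Ioi s) ∂P =
        ∫⁻ ω in F, intensityMeasure Z l σ ω (Set.Ioi s) ∂P := by
  set M : ℝ≥0 → Ω → ℝ := fun t ω => Z t ω - cumulativeIntensity l t ω with hMdef
  set dA : Ω → ℝ := fun ω =>
    cumulativeIntensity l (σ ω) ω - cumulativeIntensity l (min (σ ω) s) ω with hdA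
  set dM : Ω → ℝ := fun ω => M (σ ω) ω - M (min (σ ω) s) ω with hdM
  have hlims : ∀ ω, Tendsto (fun k => min (τ k ω) s) atTop (𝓝 (min (σ ω) s)) := fun ω =>
    (hlim ω).min tendsto_const_nhds
  -- The approximating times lie to the right of their limit, so right-continuity of `Z` suffices.
  have hZlim : ∀ {ω}, RegularPath Z l ω → ∀ {u : ℕ → ℝ≥0} {v : ℝ≥0}, (∀ k, v ≤ u k) →
      Tendsto u atTop (𝓝 v) → Tendsto (fun k => M (u k) ω) atTop (𝓝 (M v ω)) := by
    intro ω h u v huv hu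
    refine Tendsto.sub ?_ ((h.continuous_cumulativeIntensity.tendsto v).comp hu)
    exact (h.rightCts v).tendsto.comp
      (tendsto_nhdsWithin_iff.2 ⟨hu, Eventually.of_forall huv⟩)
  obtain ⟨hi, hI⟩ := hM.tendsto_setIntegral_stopped hτ hr hT (Y := fun ω => M (σ ω) ω)
    (hreg.mono fun ω h => hZlim h (fun k => hle k ω) (hlim ω))
  obtain ⟨his, hIs⟩ := hM.tendsto_setIntegral_stopped (fun k => (hτ k).coe_min_const s)
    (fun k => (hr k).range_min s) (fun k ω => min_le_right _ _) (Y := fun ω => M (min (σ ω) s) ω)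
    (hreg.mono fun ω h => hZlim h (fun k => min_le_min_right s (hle k ω)) (hlims ω))
  have hdMi : Integrable dM P := hi.sub his
  have hdM0 : ∀ F : Set Ω, MeasurableSet[𝓕 s] F → ∫ ω in F, dM ω ∂P = 0 := by
    intro F hF
    rw [integral_sub hi.integrableOn his.integrableOn, sub_eq_zero]
    refine tendsto_nhds_unique (hI F) ((hIs F).congr fun k => ?_)
    exact (hM.setIntegral_stopped_min (hτ k) (hr k) (hT k) hF).symm
  have hAm : ∀ t, Measurable (cumulativeIntensity l t) := fun t =>
    ((hA t).mono (𝓕.le t)).measurable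
  -- `σ` is not known to be a stopping time, so measurability comes from the approximations.
  have hdAm : AEMeasurable dA P := by
    refine AEMeasurable.sub ?_ ?_
    · refine aemeasurable_of_tendsto_metrizable_ae' (fun k =>
        (measurable_comp_of_countable_range hAm (hτ k) (hr k)).aemeasurable) ?_
      exact hreg.mono fun ω h => (h.continuous_cumulativeIntensity.tendsto _).comp (hlim ω)
    · refine aemeasurable_of_tendsto_metrizable_ae' (fun k =>
        (measurable_comp_of_countable_range hAm ((hτ k).coe_min_const s)
          ((hr k).range_min s)).aemeasurable) ?_
      exact hreg.mono fun ω h => (h.continuous_cumulativeIntensity.tendsto _).comp (hlims ω)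
  have hdA0 : 0 ≤ᵐ[P] dA := by
    filter_upwards [hreg] with ω h
    exact sub_nonneg.2 (h.monotone_cumulativeIntensity (min_le_left _ _))
  have hdAi : Integrable dA P := by
    refine Integrable.of_bound hdAm.aestronglyMeasurable c ?_
    filter_upwards [hreg, hc, hdA0] with ω h hcω h0
    rw [Real.norm_of_nonneg h0]
    have h1 : 0 ≤ cumulativeIntensity l (min (σ ω) s) ω :=
      intervalIntegral.integral_nonneg (NNReal.coe_nonneg _) fun u _ => h.nonneg _
    simp only [hdA]
    linarith
  have hz : (fun ω => pathMeasure Z l σ ω (Set.Ioi s)) =ᵐ[P]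
      fun ω => ENNReal.ofReal (dM ω + dA ω) := by
    filter_upwards [hreg] with ω h
    rw [pathMeasure_Ioi h]
    congr 1
    simp only [hdM, hdA, hMdef]
    ring
  have ha : (fun ω => intensityMeasure Z l σ ω (Set.Ioi s)) =ᵐ[P]
      fun ω => ENNReal.ofReal (dA ω) := hreg.mono fun ω h => intensityMeasure_Ioi h s
  have hdZ0 : 0 ≤ᵐ[P] fun ω => dM ω + dA ω := by
    filter_upwards [hreg] with ω h
    have : Z (min (σ ω) s) ω ≤ Z (σ ω) ω := h.mono (min_le_left _ _)
    simp only [hdM, hdA, hMdef, Pi.zero_apply]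
    linarith
  refine ⟨(hdMi.1.aemeasurable.add hdAm).ennreal_ofReal.congr hz.symm,
    hdAm.ennreal_ofReal.congr ha.symm, ?_, fun F hF => ?_⟩
  · rw [lintegral_congr_ae ha, ← ofReal_integral_eq_lintegral_ofReal hdAi hdA0]
    exact ENNReal.ofReal_ne_top
  · rw [lintegral_congr_ae (ae_restrict_of_ae hz), lintegral_congr_ae (ae_restrict_of_ae ha),
      ← ofReal_integral_eq_lintegral_ofReal (f := fun ω => dM ω + dA ω)
        (hdMi.add hdAi).integrableOn (ae_restrict_of_ae hdZ0),
      ← ofReal_integral_eq_lintegral_ofReal hdAi.integrableOn (ae_restrict_of_ae hdA0),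
      integral_add hdMi.integrableOn hdAi.integrableOn, hdM0 F hF, zero_add]

/-- If the level were exceeded at the infimum, continuity would give some `q k` strictly before it
where the level is already exceeded, and the cap at `q k` would contradict minimality. -/
lemma RegularPath.cumulativeIntensity_iInf_cappedTime_le {ω : Ω} (h : RegularPath Z l ω) {c : ℝ}
    (hc : 0 ≤ c) (T : ℝ≥0) {q : ℕ → ℝ≥0} (hq : DenseRange q) :
    cumulativeIntensity l (⨅ k, cappedTime (cumulativeIntensity l) c T q k ω) ω ≤ c := by
  set v := ⨅ k, cappedTime (cumulativeIntensity l) c T q k ω with hv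
  by_contra! hlt
  have hv0 : 0 < v := by
    rw [pos_iff_ne_zero]
    intro h0
    rw [h0] at hlt
    simp only [cumulativeIntensity, NNReal.coe_zero, intervalIntegral.integral_same] at hlt
    exact absurd hlt (not_lt.2 hc)
  have hU : {t | c < cumulativeIntensity l t ω} ∈ 𝓝[<] v :=
    mem_nhdsWithin_of_mem_nhds
      ((isOpen_lt continuous_const h.continuous_cumulativeIntensity).mem_nhds hlt)
  have : (𝓝[<] v).NeBot := nhdsLT_neBot_of_exists_lt ⟨0, hv0⟩
  obtain ⟨t, ht1, ht2⟩ := nonempty_of_mem (inter_mem hU self_mem_nhdsWithin)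
  obtain ⟨k, hk1, hk2⟩ := hq.exists_mem_open
    ((isOpen_lt continuous_const h.continuous_cumulativeIntensity).inter isOpen_Iio) ⟨t, ht1, ht2⟩
  have h1 : v ≤ cappedTime (cumulativeIntensity l) c T q (k + 1) ω :=
    ciInf_le (OrderBot.bddBelow _) (k + 1)
  rw [cappedTime_succ, if_pos (show c < cumulativeIntensity l (q k) ω from hk1)] at h1
  exact absurd (h1.trans (min_le_right _ _)) (not_le.2 hk2)

/-- A random time at which `Z` jumps avoids every predictable set that is null for the product of
Lebesgue measure and `P`. -/
lemma ae_notMem_of_predictable_null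
    (hreg : ∀ᵐ ω ∂P, RegularPath Z l ω)
    (hM : Martingale (fun t ω => Z t ω - cumulativeIntensity l t ω) 𝓕 P)
    (hA : StronglyAdapted 𝓕 (cumulativeIntensity l)) {R : Ω → WithTop ℝ≥0}
    (hjump : ∀ᵐ ω ∂P, ∀ t : ℝ≥0, R ω = (t : WithTop ℝ≥0) → 0 < pathJump (fun s => Z s ω) t)
    {B : Set (ℝ × Ω)} (hB : MeasurableSet[predictableSpace 𝓕] B)
    (hB0 : ∀ᵐ ω ∂P, volume ((Prod.mk · ω) ⁻¹' B ∩ Set.Ioi 0) = 0) :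
    ∀ᵐ ω ∂P, ∀ r : ℝ≥0, R ω = (r : WithTop ℝ≥0) → r ≠ 0 → ((r : ℝ), ω) ∉ B := by
  have hsec : ∀ ω, MeasurableSet ((Prod.mk · ω) ⁻¹' B) := fun ω =>
    measurable_prodMk_right (predictableSpace_le 𝓕 _ hB)
  set q := TopologicalSpace.denseSeq ℝ≥0
  -- The index `n` serves both as level for the integrated intensity and as time horizon, so that
  -- any fixed `r` is eventually covered.
  set τ : ℕ → ℕ → Ω → ℝ≥0 := fun n => cappedTime (cumulativeIntensity l) n n q with hτ
  set σ : ℕ → Ω → ℝ≥0 := fun n ω => ⨅ k, τ n k ω with hσ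
  have hmain : ∀ n, ∀ᵐ ω ∂P, pathMeasure Z l (σ n) ω ((Prod.mk · ω) ⁻¹' B) = 0 := by
    intro n
    have H := lintegral_pathMeasure_Ioi (σ := σ n) hreg hM hA
      (fun k => isStoppingTime_cappedTime hA n n q k)
      (fun k => (finite_range_cappedTime _ _ _ q k).countable)
      (fun k ω => cappedTime_le _ _ _ q k ω)
      (fun k ω => ciInf_le (OrderBot.bddBelow _) k)
      (fun ω => tendsto_atTop_ciInf (antitone_cappedTime _ _ _ q ω) (OrderBot.bddBelow _))
      (c := n) (hreg.mono fun ω h => h.cumulativeIntensity_iInf_cappedTime_le (Nat.cast_nonneg n) _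
        (TopologicalSpace.denseRange_denseSeq _))
    have hsq := lintegral_section_eq_of_predictableRectangles 𝓕 isFiniteMeasure_pathMeasure
      isFiniteMeasure_intensityMeasure pathMeasure_Iic intensityMeasure_Iic (fun s => (H s).1)
      (fun s => (H s).2.1) (by simpa using (H 0).2.2.1) (fun s F hF => (H s).2.2.2 F hF) hB
    rw [lintegral_congr_ae (hB0.mono fun ω h => intensityMeasure_eq_zero (hsec ω) h),
      lintegral_zero, lintegral_eq_zero_iff' hsq.1] at hsq
    exact hsq.2
  filter_upwards [hreg, hjump, ae_all_iff.2 hmain] with ω h hj hz r hr hr0 hmem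
  obtain ⟨n, hn⟩ := exists_nat_ge (max (r : ℝ) (cumulativeIntensity l r ω))
  have hrσ : r ≤ σ n ω := by
    refine le_ciInf fun k => le_cappedTime ?_ (fun s hs => ?_) k
    · exact_mod_cast (le_max_left _ _).trans hn
    · exact (h.monotone_cumulativeIntensity hs).trans ((le_max_right _ _).trans hn)
  have hpos := h.stieltjes_singleton_pos hr0 (hj r hr)
  have hle : h.stieltjes.measure {(r : ℝ)} ≤ pathMeasure Z l (σ n) ω ((Prod.mk · ω) ⁻¹' B) := by
    rw [pathMeasure, dif_pos h, Measure.restrict_apply (hsec ω)]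
    refine measure_mono (Set.singleton_subset_iff.2 ⟨hmem, ?_, NNReal.coe_le_coe.2 hrσ⟩)
    exact NNReal.coe_pos.2 (pos_iff_ne_zero.2 hr0)
  rw [hz n] at hle
  exact absurd hpos (not_lt.2 hle)

end Compensator

/-! ### Radon–Nikodym density of `R` and the resulting compensator -/

section Density

variable {Ω : Type*} {m : MeasurableSpace Ω}

/-- For Radon–Nikodym on the trimmed measure the exhausting sets must themselves be predictable;
complements of rectangles are. -/
lemma sigmaFinite_trim_predictableSpace (P : Measure Ω) [IsProbabilityMeasure P]
    (𝓕 : Filtration ℝ≥0 m) :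
    SigmaFinite (((volume.restrict (Set.Ioi (0 : ℝ))).prod P).trim (predictableSpace_le 𝓕)) := by
  have hms : ∀ n : ℕ, MeasurableSet[predictableSpace 𝓕] (Set.Iic (n : ℝ) ×ˢ (Set.univ : Set Ω)) := by
    intro n
    have h := (measurableSet_predictableSpace_Ioi_prod (𝓕 := 𝓕) (s := (n : ℝ≥0))
      (F := Set.univ) MeasurableSet.univ).compl
    convert h using 1
    ext p
    simp
  refine ⟨⟨⟨fun n : ℕ => Set.Iic (n : ℝ) ×ˢ (Set.univ : Set Ω), fun _ => trivial, fun n => ?_, ?_⟩⟩⟩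
  · rw [trim_measurableSet_eq _ (hms n), Measure.prod_prod, measure_univ, mul_one,
      Measure.restrict_apply measurableSet_Iic, Set.inter_comm, Set.Ioi_inter_Iic, Real.volume_Ioc]
    exact ENNReal.ofReal_lt_top
  · ext p
    simpa using exists_nat_ge p.1

variable {P : Measure Ω} [IsProbabilityMeasure P] {𝓕 : Filtration ℝ≥0 m} {R : Ω → WithTop ℝ≥0}

lemma MeasureTheory.IsStoppingTime.measurable_untopD (hR : IsStoppingTime 𝓕 R) :
    Measurable fun ω => (R ω).untopD 0 := by
  refine measurable_of_Iic fun t => ?_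
  have : (fun ω => (R ω).untopD 0) ⁻¹' Set.Iic t = {ω | R ω ≤ t} ∪ {ω | R ω = ⊤} := by
    ext ω
    simp only [Set.mem_preimage, Set.mem_Iic, Set.mem_union, Set.mem_ofPred_eq]
    cases h : R ω with
    | top => simp
    | coe r => simp only [WithTop.untopD_coe, WithTop.coe_le_coe, WithTop.coe_ne_top, or_false]
  rw [this]
  exact (𝓕.le _ _ (hR t)).union (iSup_le 𝓕.le _ hR.measurableSet_eq_top')

/-- A stopping time which avoids the predictable null sets has a predictable density. -/
lemma exists_predictable_density (hR : IsStoppingTime 𝓕 R)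
    (hnull : ∀ B : Set (ℝ × Ω), MeasurableSet[predictableSpace 𝓕] B →
      (∀ᵐ ω ∂P, volume ((Prod.mk · ω) ⁻¹' B ∩ Set.Ioi 0) = 0) →
      ∀ᵐ ω ∂P, ∀ r : ℝ≥0, R ω = (r : WithTop ℝ≥0) → r ≠ 0 → ((r : ℝ), ω) ∉ B) :
    ∃ f : ℝ × Ω → ENNReal, Measurable[predictableSpace 𝓕] f ∧
      ∀ B : Set (ℝ × Ω), MeasurableSet[predictableSpace 𝓕] B →
        P {ω | ∃ r : ℝ≥0, R ω = (r : WithTop ℝ≥0) ∧ r ≠ 0 ∧ ((r : ℝ), ω) ∈ B} =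
          ∫⁻ p in B, f p ∂((volume.restrict (Set.Ioi (0 : ℝ))).prod P) := by
  -- Restricting to `0 < R < ∞` also discards the default value `0` that `untopD` gives on `{R =
  -- ∞}`.
  set D : Set Ω := {ω | R ω ≤ (0 : ℝ≥0)}ᶜ ∩ {ω | R ω = ⊤}ᶜ with hD
  have hDm : MeasurableSet D := (𝓕.le _ _ (hR 0)).compl.inter (iSup_le 𝓕.le _ hR.measurableSet_eq_top').compl
  set g : Ω → ℝ × Ω := fun ω => (((R ω).untopD 0 : ℝ≥0), ω) with hg
  have hgm : Measurable g :=
    (measurable_coe_nnreal_real.comp hR.measurable_untopD).prodMk measurable_id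
  have hset : ∀ B, g ⁻¹' B ∩ D =
      {ω | ∃ r : ℝ≥0, R ω = (r : WithTop ℝ≥0) ∧ r ≠ 0 ∧ ((r : ℝ), ω) ∈ B} := by
    intro B
    ext ω
    simp only [hg, hD, Set.mem_inter_iff, Set.mem_preimage, Set.mem_compl_iff, Set.mem_ofPred_eq]
    cases h : R ω with
    | top =>
      simp only [not_true_eq_false, and_false, false_iff, not_exists, not_and]
      exact fun r hr => absurd hr WithTop.top_ne_coe
    | coe r =>
      simp only [WithTop.untopD_coe, WithTop.coe_le_coe, WithTop.coe_ne_top, not_false_eq_true,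
        and_true, nonpos_iff_eq_zero, WithTop.coe_inj, exists_eq_left']
      exact and_comm
  set ν := ((P.restrict D).map g).trim (predictableSpace_le 𝓕) with hν
  set κ := ((volume.restrict (Set.Ioi (0 : ℝ))).prod P).trim (predictableSpace_le 𝓕) with hκ
  have hκσ : SigmaFinite κ := sigmaFinite_trim_predictableSpace P 𝓕
  have hνf : IsFiniteMeasure ν := isFiniteMeasure_trim _
  have hν_apply : ∀ B, MeasurableSet[predictableSpace 𝓕] B →
      ν B = P {ω | ∃ r : ℝ≥0, R ω = (r : WithTop ℝ≥0) ∧ r ≠ 0 ∧ ((r : ℝ), ω) ∈ B} := by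
    intro B hB
    have hB' := predictableSpace_le 𝓕 _ hB
    rw [hν, trim_measurableSet_eq _ hB, Measure.map_apply hgm hB', Measure.restrict_apply (hgm hB'),
      hset]
  have hac : ν ≪ κ := by
    refine Measure.AbsolutelyContinuous.mk fun B hB hB0 => ?_
    have hB' := predictableSpace_le 𝓕 _ hB
    rw [hκ, trim_measurableSet_eq _ hB, Measure.prod_apply_symm hB',
      lintegral_eq_zero_iff (measurable_measure_prodMk_right hB')] at hB0
    rw [hν_apply B hB]
    have := hnull B hB (hB0.mono fun ω h =>
      (Measure.restrict_apply (measurable_prodMk_right hB')).symm.trans h)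
    rw [← compl_compl {ω | ∃ r : ℝ≥0, _}, ← mem_ae_iff]
    filter_upwards [this] with ω h
    rintro ⟨r, h1, h2, h3⟩
    exact h r h1 h2 h3
  refine ⟨ν.rnDeriv κ, Measure.measurable_rnDeriv ν κ, fun B hB => ?_⟩
  rw [← hν_apply B hB, ← Measure.withDensity_rnDeriv_eq ν κ hac, withDensity_apply _ hB,
    Measure.withDensity_rnDeriv_eq ν κ hac, hκ, restrict_trim _ _ hB,
    lintegral_trim _ (Measure.measurable_rnDeriv _ _)]

lemma measurableSet_predictableSpace_Ioc_prod {s t : ℝ≥0} {F : Set Ω} (hF : MeasurableSet[𝓕 s] F) :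
    MeasurableSet[predictableSpace 𝓕] (Set.Ioc (s : ℝ) t ×ˢ F) := by
  have h := (measurableSet_predictableSpace_Ioi_prod hF).diff
    (measurableSet_predictableSpace_Ioi_prod (𝓕 := 𝓕) (s := t) (F := Set.univ) MeasurableSet.univ)
  convert h using 1
  ext p
  simp only [Set.mem_prod, Set.mem_Ioc, Set.mem_sdiff, Set.mem_Ioi, Set.mem_univ, and_true, not_lt]
  tauto

/-- On `(0, t]` the integrand equals its version frozen at `t`, which is jointly measurable over `𝓕
t`, so integrating out time preserves `𝓕 t`-measurability. -/
lemma stronglyMeasurable_integral_predictable {f : ℝ × Ω → ENNReal}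
    (hf : Measurable[predictableSpace 𝓕] f) (t : ℝ≥0) :
    StronglyMeasurable[𝓕 t] fun ω =>
      ∫ s in (0 : ℝ)..(t : ℝ), (f ((s.toNNReal : ℝ), ω)).toReal := by
  have h1 := (hf.comp (measurable_min_predictableSpace 𝓕 t)).ennreal_toReal
  have h2 := @StronglyMeasurable.integral_prod_left' ℝ Ω ℝ _ (𝓕 t) (volume.restrict (Set.Ioc 0 (t : ℝ)))
    _ _ _ _ (h1.stronglyMeasurable)
  convert h2 using 2 with ω
  rw [intervalIntegral.integral_of_le t.coe_nonneg]
  refine setIntegral_congr_fun measurableSet_Ioc fun s hs => ?_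
  simp only [Function.comp_apply]
  rw [Real.coe_toNNReal s hs.1.le, min_eq_left hs.2]

/-- A stopping time with a predictable density has an absolutely continuous compensator. -/
lemma hasACCompensator_of_density (hR : IsStoppingTime 𝓕 R) {f : ℝ × Ω → ENNReal}
    (hf : Measurable[predictableSpace 𝓕] f)
    (hfR : ∀ B : Set (ℝ × Ω), MeasurableSet[predictableSpace 𝓕] B →
      P {ω | ∃ r : ℝ≥0, R ω = (r : WithTop ℝ≥0) ∧ r ≠ 0 ∧ ((r : ℝ), ω) ∈ B} =
        ∫⁻ p in B, f p ∂((volume.restrict (Set.Ioi (0 : ℝ))).prod P)) :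
    HasACCompensator 𝓕 P (timeIndicator R) := by
  have hfm : Measurable f := hf.mono (predictableSpace_le 𝓕) le_rfl
  have hfω : ∀ ω, Measurable fun s : ℝ => f (s, ω) := fun ω => hfm.comp measurable_prodMk_right
  set H : ℝ≥0 → ℝ≥0 → Ω → ENNReal := fun s t ω => ∫⁻ u in Set.Ioc (s : ℝ) t, f (u, ω) with hH
  have hHm : ∀ s t, Measurable (H s t) := fun s t => hfm.lintegral_prod_left'
  have hHF : ∀ {s t : ℝ≥0} {F : Set Ω}, MeasurableSet[𝓕 s] F →
      ∫⁻ ω in F, H s t ω ∂P = P (F ∩ ({ω | R ω ≤ t} \ {ω | R ω ≤ s})) := by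
    intro s t F hF
    have hsub : Set.Ioc (s : ℝ) t ⊆ Set.Ioi 0 := fun u hu => s.coe_nonneg.trans_lt hu.1
    have h := hfR _ (measurableSet_predictableSpace_Ioc_prod (t := t) hF)
    rw [← Measure.prod_restrict, Measure.restrict_restrict measurableSet_Ioc,
      Set.inter_eq_left.2 hsub, lintegral_prod_symm' _ hfm] at h
    rw [← h]
    congr 1
    ext ω
    simp only [Set.mem_inter_iff, Set.mem_sdiff, Set.mem_ofPred_eq, Set.mem_prod, Set.mem_Ioc,
      NNReal.coe_lt_coe, NNReal.coe_le_coe]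
    cases hRω : R ω with
    | top =>
      refine ⟨fun ⟨r, hr, _⟩ => absurd hr WithTop.top_ne_coe, fun h => absurd h.2.1 ?_⟩
      exact not_le.2 (WithTop.coe_lt_top t)
    | coe r =>
      simp only [WithTop.coe_inj, exists_eq_left', WithTop.coe_le_coe, not_le]
      exact ⟨fun h => ⟨h.2.2, h.2.1.2, h.2.1.1⟩,
        fun h => ⟨(pos_of_gt h.2.2).ne', ⟨h.2.2, h.2.1⟩, h.1⟩⟩
  have hH1 : ∀ t, ∫⁻ ω, H 0 t ω ∂P ≠ ⊤ := by
    intro t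
    have := hHF (s := 0) (t := t) (F := Set.univ) MeasurableSet.univ
    rw [Measure.restrict_univ] at this
    rw [this]
    exact measure_ne_top _ _
  have hHfin : ∀ t, ∀ᵐ ω ∂P, H 0 t ω < ⊤ := fun t => ae_lt_top (hHm 0 t) (hH1 t)
  have hHle : ∀ {s t : ℝ≥0}, s ≤ t → ∀ ω, H 0 s ω ≤ H 0 t ω := fun hst ω =>
    lintegral_mono_set (Set.Ioc_subset_Ioc_right (NNReal.coe_le_coe.2 hst))
  have hHadd : ∀ {s t : ℝ≥0}, s ≤ t → ∀ ω, H 0 t ω = H 0 s ω + H s t ω := by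
    intro s t hst ω
    simp only [hH]
    rw [← lintegral_union measurableSet_Ioc (Set.Ioc_disjoint_Ioc_of_le le_rfl),
      Set.Ioc_union_Ioc_eq_Ioc (NNReal.coe_le_coe.2 zero_le) (NNReal.coe_le_coe.2 hst)]
  set b : ℝ≥0 → Ω → ℝ := fun t ω => ∫ s in (0 : ℝ)..(t : ℝ), (f ((s.toNNReal : ℝ), ω)).toReal with hb
  have hbH : ∀ t, b t =ᵐ[P] fun ω => (H 0 t ω).toReal := by
    intro t
    filter_upwards [hHfin t] with ω hω
    simp only [hb, hH, NNReal.coe_zero]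
    rw [intervalIntegral.integral_of_le t.coe_nonneg, ← integral_toReal (hfω ω).aemeasurable]
    · refine setIntegral_congr_fun measurableSet_Ioc fun s hs => ?_
      simp only [Real.coe_toNNReal s hs.1.le]
    · simp only [hH, NNReal.coe_zero] at hω
      exact ae_lt_top (hfω ω) hω.ne
  have hbi : ∀ t, Integrable (b t) P := fun t =>
    (integrable_toReal_of_lintegral_ne_top (hHm 0 t).aemeasurable (hH1 t)).congr (hbH t).symm
  have hbint : ∀ t (F : Set Ω), ∫ ω in F, b t ω ∂P = (∫⁻ ω in F, H 0 t ω ∂P).toReal := by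
    intro t F
    rw [integral_congr_ae (ae_restrict_of_ae (hbH t)), integral_toReal (hHm 0 t).aemeasurable
      (ae_restrict_of_ae (hHfin t))]
  have hRm : ∀ t : ℝ≥0, MeasurableSet {ω | R ω ≤ t} := fun t => 𝓕.le t _ (hR t)
  have hXi : ∀ t, Integrable (timeIndicator R t) P := fun t =>
    (integrable_const (1 : ℝ)).indicator (hRm t)
  have hXint : ∀ (t : ℝ≥0) {F : Set Ω}, MeasurableSet F →
      ∫ ω in F, timeIndicator R t ω ∂P = (P (F ∩ {ω | R ω ≤ t})).toReal := by
    intro t F hF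
    have : ∫ ω in F, timeIndicator R t ω ∂P = ∫ ω in F, {ω | R ω ≤ t}.indicator (fun _ => (1 : ℝ)) ω ∂P :=
      rfl
    rw [this, setIntegral_indicator (hRm t), setIntegral_const, smul_eq_mul, mul_one]
    rfl
  -- Passing to `toReal` loses nothing: almost surely the density has finite integral on each `(0,
  -- t]`, hence is finite for almost every time.
  refine ⟨fun t ω => (f ((t : ℝ), ω)).toReal, fun t ω => ENNReal.toReal_nonneg, fun t => ?_, ?_,
    fun t => ?_, fun s t hst => ?_⟩
  · exact (hf.comp (measurable_prodMk_predictableSpace 𝓕 t)).ennreal_toReal.stronglyMeasurable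
  · have hall : ∀ᵐ ω ∂P, ∀ n : ℕ, H 0 n ω < ⊤ := ae_all_iff.2 fun n => hHfin n
    filter_upwards [hall] with ω hω t
    rw [intervalIntegrable_iff_integrableOn_Ioc_of_le t.coe_nonneg]
    obtain ⟨n, hn⟩ := exists_nat_ge t
    have ht : H 0 t ω ≠ ⊤ := ((hHle hn ω).trans_lt (hω n)).ne
    simp only [hH, NNReal.coe_zero] at ht
    refine IntegrableOn.congr_fun (f := fun s => (f (s, ω)).toReal)
      (integrable_toReal_of_lintegral_ne_top (hfω ω).aemeasurable ht) (fun s hs => ?_)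
      measurableSet_Ioc
    simp only [Real.coe_toNNReal s hs.1.le]
  · exact (stronglyMeasurable_const.indicator (hR t)).sub
      (stronglyMeasurable_integral_predictable hf t)
  · refine (ae_eq_condExp_of_forall_setIntegral_eq (𝓕.le s) ((hXi t).sub (hbi t))
      (fun F _ _ => ((hXi s).sub (hbi s)).integrableOn) (fun F hF _ => ?_)
      ((stronglyMeasurable_const.indicator (hR s)).sub
        (stronglyMeasurable_integral_predictable hf s)).aestronglyMeasurable).symm
    have hF' := 𝓕.le s _ hF
    have hsub : {ω | R ω ≤ s} ⊆ {ω | R ω ≤ t} := fun ω h =>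
      le_trans h (WithTop.coe_le_coe.2 hst)
    have e1 : P (F ∩ {ω | R ω ≤ t}) =
        P (F ∩ {ω | R ω ≤ s}) + P (F ∩ ({ω | R ω ≤ t} \ {ω | R ω ≤ s})) := by
      rw [← measure_union _ (hF'.inter ((hRm t).diff (hRm s))), ← Set.inter_union_distrib_left,
        Set.union_sdiff_cancel hsub]
      exact (Set.disjoint_sdiff_right).mono Set.inter_subset_right Set.inter_subset_right
    have e2 : ∫⁻ ω in F, H 0 t ω ∂P = ∫⁻ ω in F, H 0 s ω ∂P + ∫⁻ ω in F, H s t ω ∂P := by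
      rw [← lintegral_add_left (hHm 0 s)]
      exact lintegral_congr fun ω => hHadd hst ω
    have hne : ∫⁻ ω in F, H 0 s ω ∂P ≠ ⊤ :=
      ne_top_of_le_ne_top (hH1 s) (setLIntegral_le_lintegral _ _)
    have e3 : ∫ ω in F, (timeIndicator R s ω - b s ω) ∂P =
        ∫ ω in F, (timeIndicator R t ω - b t ω) ∂P := by
      rw [integral_sub (hXi s).integrableOn (hbi s).integrableOn,
        integral_sub (hXi t).integrableOn (hbi t).integrableOn, hXint s hF', hXint t hF', hbint,
        hbint, e1, e2, hHF hF, ENNReal.toReal_add (measure_ne_top _ _) (measure_ne_top _ _),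
        ENNReal.toReal_add hne (measure_ne_top _ _)]
      ring
    exact e3

end Density

/-! ### Assembly -/

theorem theoremt6 {Ω : Type*} {m : MeasurableSpace Ω} (P : Measure Ω) [IsProbabilityMeasure P]
    (𝓕 : Filtration ℝ≥0 m) (Z : ℝ≥0 → Ω → ℝ)
    (hZ : IsIncreasingProcess 𝓕 P Z) (hZc : HasACCompensator 𝓕 P Z)
    (R : Ω → WithTop ℝ≥0) (hR : IsStoppingTime 𝓕 R)
    (hjump : ∀ᵐ ω ∂P, ∀ t : ℝ≥0, R ω = (t : WithTop ℝ≥0) → 0 < pathJump (fun s => Z s ω) t) :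
    HasACCompensator 𝓕 P (timeIndicator R) := by
  obtain ⟨l, hl0, -, hli, hM⟩ := hZc
  have hreg : ∀ᵐ ω ∂P, RegularPath Z l ω := by
    filter_upwards [hZ.monotone, hZ.rightCts, hli] with ω h1 h2 h3
    exact ⟨h1, h2, fun t => hl0 t ω, h3⟩
  -- `l` is only adapted, with no joint measurability, so its integral is shown adapted as the
  -- difference of `Z` and the martingale.
  have hA : StronglyAdapted 𝓕 (cumulativeIntensity l) := by
    intro t
    have h := (hZ.adapted t).sub (hM.1 t)
    convert h using 1
    ext ω
    simp [cumulativeIntensity]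
  obtain ⟨f, hf, hfR⟩ := exists_predictable_density hR fun B hB hB0 =>
    ae_notMem_of_predictable_null hreg hM hA hjump hB hB0
  exact hasACCompensator_of_density hR hf hfR
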